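/- Let $\mathcal A$ be a unital $C^*$-algebra and let $\Gamma^+=\{x\in\Gamma: x\ge 0\}$ be the positive cone of a totally ordered abelian group $\Gamma$. An *action* of $\Gamma^+$ on $\mathcal A$ is a family $\mathcal V=(\mathcal V_x)_{x\in\Gamma^+}$ of positive linear maps $\mathcal V_x:\mathcal A\to\mathcal A$ with $\mathcal V_0=\mathrm{Id}$ and $\mathcal V_x\circ\mathcal V_y=\mathcal V_{x+y}$. A pair of actions $(\mathcal V,\mathcal H)$ is a *complete interaction* if for all $x,y\in\Gamma^+$ and $a,b\in\mathcal A$: $\mathcal V_x\mathcal H_x\mathcal V_x=\mathcal V_x$ and $\mathcal H_x\mathcal V_x\mathcal H_x=\mathcal H_x$; $\mathcal V_x(ab)=\mathcal V_x(a)\mathcal V_x(b)$ whenever $a$ or $b$ lies in $\mathcal H_x(\mathcal A)$, and $\mathcal H_x(ab)=\mathcal H_x(a)\mathcal H_x(b)$ whenever $a$ or $b$ lies in $\mathcal V_x(\mathcal A)$; $\mathcal H_x(\mathcal V_x(a))=\mathcal H_x(1)a\mathcal H_x(1)$, $\mathcal V_x(\mathcal H_x(a))=\mathcal V_x(1)a\mathcal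 V_x(1)$, and $\mathcal H_y(1)\mathcal V_x(1)=\mathcal V_x(1)\mathcal H_y(1)$. An action $\mathcal V$ is *finely representable* if there are a unital $C^*$-algebra $C$, an injective unital $*$-homomorphism $\sigma:\mathcal A\to C$ and partial isometries $U_x\in C$ ($x\in\Gamma^+$) with $U_xU_y=U_{x+y}$, $\sigma(\mathcal V_x(a))=U_x\sigma(a)U_x^*$ and $U_x^*\sigma(a)U_x\in\sigma(\mathcal A)$ for all $x,y\in\Gamma^+$, $a\in\mathcal A$. Let $\mathcal V$ be a finely representable action of $\Gamma^+$ on $\mathcal A$ and $(\mathcal V,\mathcal H)$ the corresponding complete interaction. Let $\mathcal A\rtimes_{(\mathcal V,\mathcal H)}\Gamma$ be the crossed product, i.e. the universal unital $C^*$-algebra generated by a unital $*$-homomorphic image of $\mathcal A$ (an element $a\in\mathcal A$ and its image are denoted by the same letter) and partial isometries $\hat U_x$, $x\in\Gamma^+$, subject to $\mathcal V_x(a)=\hat U_xa\hat U_x^*$, $\mathcal H_x(a)=\hat U_x^*a\hat U_x$ and $\hat U_x\hat U_y=\hat U_{x+y}$. Let $C_0$ be the $*$-subalgebra of it generated by $\mathcal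 A$ and all $\hat U_x$. A *quasi-monomial* $q_x$ (respectively $q_{-x}$) of degree $x\in\Gamma^+$ of positive (respectively negative) type is a finite sum of products $a_1\hat U_{x_1}a_2\hat U_{x_2}\cdots a_n\hat U_{x_n}$ (respectively $a_1\hat U_{x_1}^*a_2\hat U_{x_2}^*\cdots a_n\hat U_{x_n}^*$) with $n\ge1$, $a_i\in\mathcal A$, $x_i\in\Gamma^+$ and $x_1+\dots+x_n=x$, where $n$, the $a_i$ and the $x_i$ may vary from summand to summand. Then: 1. For every $a\in C_0$ and every presentation $$a=\sum_{x\in F}q_{-x}+a_0+\sum_{x\in F}q_x\qquad(*)$$ with $F\subset\Gamma^+\setminus\{0\}$ finite, $q_{-x}$ and $q_x$ quasi-monomials of degree $x$ of negative and positive type, and $a_0\in\mathcal A$, one has $\|a_0\|_{\mathcal A}\le\|a\|$. 2. Every $a\in C_0$ has a presentation $(*)$, and $a_0\in\mathcal A$ is the same in all presentations of $a$. Thus $E_0(a)=a_0$ is a well-defined map $E_0:C_0\to\mathcal A$. 3. $E_0$ extends to a conditional expectation $E$ of $\mathcal A\rtimes_{(\mathcal V,\mathcal H)}\Gamma$ onto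 $\mathcal A$, i.e. to a linear map $E:\mathcal A\rtimes_{(\mathcal V,\mathcal H)}\Gamma\to\mathcal A$ that is positive and contractive and satisfies $E(c)=c$ and $E(cbd)=cE(b)d$ for all $c,d\in\mathcal A$ and $b\in\mathcal A\rtimes_{(\mathcal V,\mathcal H)}\Gamma$. -/

import Mathlib

universe u v w

set_option linter.unusedSectionVars false
set_option linter.style.haveILetI false

noncomputable section

namespace CovAlg

/-! ### Actions, interactions, finely representable actions -/

/-- The positive cone `Γ⁺ = {x ∈ Γ : 0 ≤ x}` of a totally ordered abelian group. -/
abbrev PosCone (Γ : Type v) [AddCommGroup Γ] [LinearOrder Γ] : Type v := {x : Γ // 0 ≤ x}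

section Interactions

variable {A : Type u} [CStarAlgebra A] [PartialOrder A] [StarOrderedRing A]
variable {Γ : Type v} [AddCommGroup Γ] [LinearOrder Γ] [IsOrderedAddMonoid Γ]

/-- An action of `Γ⁺` on `A` by positive linear maps: `𝒱₀ = Id` and `𝒱ₓ ∘ 𝒱_y = 𝒱_{x+y}`.
(Positive linear maps between C⋆-algebras are automatically bounded.) -/
structure IsAction (V : PosCone Γ → A →ₚ[ℂ] A) : Prop where
  map_zero : ∀ a, V 0 a = a
  map_add : ∀ x y a, V x (V y a) = V (x + y) a

/-- An interaction `(𝒱, ℋ)` of two actions. -/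
structure IsInteraction (V H : PosCone Γ → A →ₚ[ℂ] A) : Prop where
  left : IsAction V
  right : IsAction H
  vhv : ∀ x a, V x (H x (V x a)) = V x a
  hvh : ∀ x a, H x (V x (H x a)) = H x a
  v_mul : ∀ x a b, (a ∈ Set.range (H x) ∨ b ∈ Set.range (H x)) → V x (a * b) = V x a * V x b
  h_mul : ∀ x a b, (a ∈ Set.range (V x) ∨ b ∈ Set.range (V x)) → H x (a * b) = H x a * H x b

/-- A complete interaction. -/
structure IsCompleteInteraction (V H : PosCone Γ → A →ₚ[ℂ] A) : Prop
    extends IsInteraction V H where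
  hv : ∀ x a, H x (V x a) = H x 1 * a * H x 1
  vh : ∀ x a, V x (H x a) = V x 1 * a * V x 1
  comm : ∀ x y, H y 1 * V x 1 = V x 1 * H y 1

/-- `(C, σ, U)` is a covariant representation of `𝒱`: `σ` is a unital ⋆-monomorphism and
`U` is a semigroup homomorphism of `Γ⁺` into the multiplicative semigroup of `C` whose values are
partial isometries, satisfying the covariance conditions. -/
structure IsCovariantRep (V : PosCone Γ → A →ₚ[ℂ] A) {C : Type w} [CStarAlgebra C]
    (σ : A →⋆ₐ[ℂ] C) (U : PosCone Γ → C) : Prop where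
  injective : Function.Injective σ
  map_add : ∀ x y, U x * U y = U (x + y)
  partialIsometry : ∀ x, U x * star (U x) * U x = U x
  covariant : ∀ x a, σ (V x a) = U x * σ a * star (U x)
  mem_range : ∀ x a, star (U x) * σ a * U x ∈ Set.range σ

/-- The action `𝒱` is finely representable if it has a covariant representation in some unital
C⋆-algebra. -/
def IsFinelyRepresentable (V : PosCone Γ → A →ₚ[ℂ] A) : Prop :=
  ∃ (C : Type w) (_ : CStarAlgebra C) (σ : A →⋆ₐ[ℂ] C) (U : PosCone Γ → C), IsCovariantRep V σ U

end Interactions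

/-! ### The crossed product

The universal unital C⋆-algebra on generators `a ∈ A`, `Ûₓ` (`x ∈ Γ⁺`) is constructed as the
Hausdorff completion of the free unital ⋆-algebra on these generators with respect to the
largest C⋆-seminorm which vanishes on the relations. -/

/-- Free generators: the elements of `A`, the symbols `Ûₓ`, and their formal adjoints `Ûₓ⋆`. -/
inductive Gen (A : Type u) (P : Type v) : Type (max u v)
  | ofA (a : A)
  | ofU (x : P)
  | ofUstar (x : P)

variable {A : Type u} [CStarAlgebra A] [PartialOrder A] [StarOrderedRing A]
variable {Γ : Type v} [AddCommGroup Γ] [LinearOrder Γ] [IsOrderedAddMonoid Γ]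

/-- The free unital complex algebra on the generators. The parameters `V H` do not enter
the algebra; they enter the seminorm with which it is equipped below. -/
def Word (_V _H : PosCone Γ → A →ₚ[ℂ] A) : Type (max u v) := FreeAlgebra ℂ (Gen A (PosCone Γ))

variable {V H : PosCone Γ → A →ₚ[ℂ] A}

namespace Word

instance : Ring (Word V H) := inferInstanceAs (Ring (FreeAlgebra ℂ (Gen A (PosCone Γ))))

instance : Algebra ℂ (Word V H) :=
  inferInstanceAs (Algebra ℂ (FreeAlgebra ℂ (Gen A (PosCone Γ))))

/-- A generator, as an element of the free algebra. -/
def of (V H : PosCone Γ → A →ₚ[ℂ] A) (g : Gen A (PosCone Γ)) : Word V H := FreeAlgebra.ι ℂ g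

/-- The element of the free algebra given by `a ∈ A`. -/
def ofA (V H : PosCone Γ → A →ₚ[ℂ] A) (b : A) : Word V H := of V H (.ofA b)

/-- The element `Ûₓ` of the free algebra. -/
def ofU (V H : PosCone Γ → A →ₚ[ℂ] A) (x : PosCone Γ) : Word V H := of V H (.ofU x)

theorem induction {motive : Word V H → Prop}
    (scalar : ∀ c : ℂ, motive (algebraMap ℂ (Word V H) c)) (gen : ∀ g, motive (of V H g))
    (mul : ∀ v w, motive v → motive w → motive (v * w))
    (add : ∀ v w, motive v → motive w → motive (v + w)) (w : Word V H) : motive w :=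
  FreeAlgebra.induction ℂ (Gen A (PosCone Γ)) scalar gen mul add w

/-- The adjoint of a free generator. The generators from `A` get the adjoint in `A`. -/
def starGen : Gen A (PosCone Γ) → Gen A (PosCone Γ)
  | .ofA b => .ofA (star b)
  | .ofU x => .ofUstar x
  | .ofUstar x => .ofU x

theorem starGen_starGen (g : Gen A (PosCone Γ)) : starGen (starGen g) = g := by
  cases g <;> simp [starGen]

/-- The conjugate-linear antimultiplicative extension of `starGen`, as a ring homomorphism into
the opposite ring. -/
def starHom : Word V H →+* (Word V H)ᵐᵒᵖ :=
  letI : Algebra ℂ (Word V H)ᵐᵒᵖ :=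
    RingHom.toAlgebra' ((algebraMap ℂ (Word V H)ᵐᵒᵖ).comp (starRingEnd ℂ))
      (fun c x => Algebra.commutes (starRingEnd ℂ c) x)
  (FreeAlgebra.lift ℂ (A := (Word V H)ᵐᵒᵖ)
    (fun g => MulOpposite.op (of V H (starGen g)))).toRingHom

theorem starHom_of (g : Gen A (PosCone Γ)) :
    starHom (of V H g) = MulOpposite.op (of V H (starGen g)) := by
  letI : Algebra ℂ (Word V H)ᵐᵒᵖ :=
    RingHom.toAlgebra' ((algebraMap ℂ (Word V H)ᵐᵒᵖ).comp (starRingEnd ℂ))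
      (fun c x => Algebra.commutes (starRingEnd ℂ c) x)
  exact FreeAlgebra.lift_ι_apply (R := ℂ) (A := (Word V H)ᵐᵒᵖ)
    (fun g => MulOpposite.op (of V H (starGen g))) g

theorem starHom_algebraMap (c : ℂ) :
    starHom (algebraMap ℂ (Word V H) c) =
      MulOpposite.op (algebraMap ℂ (Word V H) (starRingEnd ℂ c)) := by
  letI : Algebra ℂ (Word V H)ᵐᵒᵖ :=
    RingHom.toAlgebra' ((algebraMap ℂ (Word V H)ᵐᵒᵖ).comp (starRingEnd ℂ))
      (fun c x => Algebra.commutes (starRingEnd ℂ c) x)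
  exact (FreeAlgebra.lift ℂ (A := (Word V H)ᵐᵒᵖ)
    (fun g => MulOpposite.op (of V H (starGen g)))).commutes c

instance : StarRing (Word V H) where
  star w := (starHom w).unop
  star_involutive w := by
    induction w using Word.induction with
    | scalar c => simp [starHom_algebraMap]
    | gen g => simp [starHom_of, starGen_starGen]
    | mul v w hv hw => simp_all
    | add v w hv hw => simp_all
  star_mul v w := by simp
  star_add v w := by simp

theorem star_def (w : Word V H) : star w = (starHom w).unop := rfl

@[simp] theorem star_of (g : Gen A (PosCone Γ)) : star (of V H g) = of V H (starGen g) := by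
  simp [star_def, starHom_of]

theorem star_algebraMap (c : ℂ) :
    star (algebraMap ℂ (Word V H) c) = algebraMap ℂ (Word V H) (star c) := by
  simp [star_def, starHom_algebraMap]

instance : StarModule ℂ (Word V H) where
  star_smul c w := by
    rw [Algebra.smul_def, star_mul, star_algebraMap, Algebra.smul_def, Algebra.commutes]

end Word

open Word

/-- The defining relations `v = w` of the crossed product: the ⋆-algebra operations and the unit
of `A` are respected, the `Ûₓ` are partial isometries forming a semigroup, and
`𝒱ₓ(a) = Ûₓ a Ûₓ⋆`, `ℋₓ(a) = Ûₓ⋆ a Ûₓ`. -/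
inductive Rel (V H : PosCone Γ → A →ₚ[ℂ] A) : Word V H → Word V H → Prop
  | add (b c : A) : Rel V H (ofA V H (b + c)) (ofA V H b + ofA V H c)
  | smul (z : ℂ) (b : A) : Rel V H (ofA V H (z • b)) (z • ofA V H b)
  | mul (b c : A) : Rel V H (ofA V H (b * c)) (ofA V H b * ofA V H c)
  | one : Rel V H (ofA V H 1) 1
  | star (b : A) : Rel V H (ofA V H (Star.star b)) (Star.star (ofA V H b))
  | partialIsometry (x : PosCone Γ) :
      Rel V H (ofU V H x * Star.star (ofU V H x) * ofU V H x) (ofU V H x)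
  | semigroup (x y : PosCone Γ) : Rel V H (ofU V H x * ofU V H y) (ofU V H (x + y))
  | left (x : PosCone Γ) (b : A) :
      Rel V H (ofA V H (V x b)) (ofU V H x * ofA V H b * Star.star (ofU V H x))
  | right (x : PosCone Γ) (b : A) :
      Rel V H (ofA V H (H x b)) (Star.star (ofU V H x) * ofA V H b * ofU V H x)

/-- A C⋆-seminorm on the free ⋆-algebra vanishing on the relations. These are exactly the
functions `w ↦ ‖π w‖` for unital ⋆-homomorphisms `π` into C⋆-algebras respecting the relations. -/
structure IsCovariantSeminorm (p : Seminorm ℂ (Word V H)) : Prop where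
  mul_le : ∀ v w, p (v * w) ≤ p v * p w
  cstar : ∀ w, p (star w * w) = p w ^ 2
  rel : ∀ v w, Rel V H v w → p (v - w) = 0

variable (V H) in
/-- The type of all C⋆-seminorms vanishing on the relations. -/
def CovSeminorm : Type (max u v) := {p : Seminorm ℂ (Word V H) // IsCovariantSeminorm p}

namespace CovSeminorm

instance : Inhabited (CovSeminorm V H) :=
  ⟨⟨0, by constructor <;> simp⟩⟩

theorem eq_of_rel (p : CovSeminorm V H) {v w : Word V H} (h : Rel V H v w) : p.1 v = p.1 w := by
  have h0 := p.2.rel v w h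
  have h1 := map_sub_rev p.1 v w
  have h2 := map_add_le_add p.1 (v - w) w
  have h3 := map_add_le_add p.1 (w - v) v
  simp only [sub_add_cancel] at h2 h3
  linarith

theorem eq_of_sub (p : CovSeminorm V H) {v w : Word V H} (h : p.1 (v - w) = 0) :
    p.1 v = p.1 w := by
  have h1 := map_sub_rev p.1 v w
  have h2 := map_add_le_add p.1 (v - w) w
  have h3 := map_add_le_add p.1 (w - v) v
  simp only [sub_add_cancel] at h2 h3
  linarith

theorem le_star (p : CovSeminorm V H) (w : Word V H) : p.1 w ≤ p.1 (star w) := by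
  have h := p.2.cstar w
  have h1 := p.2.mul_le (star w) w
  have h2 := apply_nonneg p.1 w
  have h3 := apply_nonneg p.1 (star w)
  rcases h2.eq_or_lt with h4 | h4
  · linarith
  · exact le_of_mul_le_mul_right (by nlinarith) h4

theorem map_star (p : CovSeminorm V H) (w : Word V H) : p.1 (star w) = p.1 w :=
  le_antisymm (by simpa using p.le_star (star w)) (p.le_star w)

theorem one_le (p : CovSeminorm V H) : p.1 1 ≤ 1 := by
  have h := p.2.cstar 1
  simp only [star_one, mul_one] at h
  nlinarith

theorem u_le (p : CovSeminorm V H) (x : PosCone Γ) : p.1 (ofU V H x) ≤ 1 := by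
  have h := p.2.cstar (ofU V H x)
  have h1 := p.2.cstar (star (ofU V H x) * ofU V H x)
  have h2 : p.1 (star (star (ofU V H x) * ofU V H x) * (star (ofU V H x) * ofU V H x)
      - star (ofU V H x) * ofU V H x) = 0 := by
    have h3 := p.2.mul_le (star (ofU V H x))
      (ofU V H x * star (ofU V H x) * ofU V H x - ofU V H x)
    rw [p.2.rel _ _ (Rel.partialIsometry x), mul_zero] at h3
    refine le_antisymm (le_trans (le_of_eq ?_) h3) (apply_nonneg _ _)
    congr 1
    simp only [star_mul, star_star]
    noncomm_ring
  rw [p.eq_of_sub h2, h] at h1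
  by_contra! h5
  have h6 : 1 < p.1 (ofU V H x) ^ 2 := one_lt_pow₀ h5 two_ne_zero
  nlinarith

theorem unitary_le (p : CovSeminorm V H) (b : unitary A) : p.1 (ofA V H (b : A)) ≤ 1 := by
  have h := p.2.cstar (ofA V H (b : A))
  have h2 : p.1 (star (ofA V H (b : A)) * ofA V H (b : A) - 1) = 0 := by
    have e : star (ofA V H (b : A)) * ofA V H (b : A) - 1 =
        - ((ofA V H (star (b : A)) - star (ofA V H (b : A))) * ofA V H (b : A))
        - (ofA V H (star (b : A) * (b : A)) - ofA V H (star (b : A)) * ofA V H (b : A))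
        + (ofA V H (1 : A) - 1) := by
      rw [Unitary.coe_star_mul_self]
      noncomm_ring
    rw [e]
    have h3 := p.2.mul_le (ofA V H (star (b : A)) - star (ofA V H (b : A))) (ofA V H (b : A))
    rw [p.2.rel _ _ (Rel.star _), zero_mul] at h3
    have h4 := p.2.rel _ _ (Rel.mul (V := V) (H := H) (star (b : A)) (b : A))
    have h5 := p.2.rel _ _ (Rel.one (V := V) (H := H))
    refine le_antisymm ?_ (apply_nonneg _ _)
    refine (map_add_le_add p.1 _ _).trans ?_
    have h6 := map_sub_le_add p.1
      (- ((ofA V H (star (b : A)) - star (ofA V H (b : A))) * ofA V H (b : A)))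
      (ofA V H (star (b : A) * (b : A)) - ofA V H (star (b : A)) * ofA V H (b : A))
    rw [map_neg_eq_map] at h6
    linarith
  rw [p.eq_of_sub h2] at h
  have := p.one_le
  nlinarith

theorem bounded (w : Word V H) : BddAbove (Set.range fun p : CovSeminorm V H => p.1 w) := by
  suffices ∃ M, ∀ p : CovSeminorm V H, p.1 w ≤ M by
    obtain ⟨M, hM⟩ := this
    exact ⟨M, by rintro _ ⟨p, rfl⟩; exact hM p⟩
  induction w using Word.induction with
  | scalar c =>
    refine ⟨‖c‖, fun p => ?_⟩
    rw [Algebra.algebraMap_eq_smul_one, map_smul_eq_mul]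
    exact mul_le_of_le_one_right (norm_nonneg c) p.one_le
  | gen g =>
    cases g with
    | ofA b =>
      obtain ⟨t, c, hb, -⟩ := CStarAlgebra.exists_sum_four_unitary b
      refine ⟨∑ i, ‖c i‖, fun p => ?_⟩
      change p.1 (ofA V H b) ≤ _
      have key : ∀ s : Finset (Fin 4),
          p.1 (ofA V H (∑ i ∈ s, c i • (t i : A))) ≤ ∑ i ∈ s, ‖c i‖ := by
        intro s
        induction s using Finset.induction_on with
        | empty =>
          have := p.eq_of_rel (Rel.smul (V := V) (H := H) 0 0)
          simp only [zero_smul, map_zero] at this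
          simp [this]
        | insert i s hi ih =>
          rw [Finset.sum_insert hi, Finset.sum_insert hi, p.eq_of_rel (Rel.add _ _)]
          refine (map_add_le_add p.1 _ _).trans (add_le_add ?_ ih)
          rw [p.eq_of_rel (Rel.smul _ _), map_smul_eq_mul]
          exact mul_le_of_le_one_right (norm_nonneg _) (p.unitary_le (t i))
      rw [hb]
      exact key Finset.univ
    | ofU x => exact ⟨1, fun p => p.u_le x⟩
    | ofUstar x =>
      refine ⟨1, fun p => ?_⟩
      have := p.map_star (ofU V H x)
      rw [ofU, star_of] at this
      exact this.trans_le (p.u_le x)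
  | mul v w hv hw =>
    obtain ⟨M, hM⟩ := hv
    obtain ⟨N, hN⟩ := hw
    refine ⟨M * N, fun p => (p.2.mul_le v w).trans ?_⟩
    exact mul_le_mul (hM p) (hN p) (apply_nonneg _ _) ((apply_nonneg _ _).trans (hM p))
  | add v w hv hw =>
    obtain ⟨M, hM⟩ := hv
    obtain ⟨N, hN⟩ := hw
    exact ⟨M + N, fun p => (map_add_le_add p.1 v w).trans (add_le_add (hM p) (hN p))⟩

end CovSeminorm

namespace Word

/-- The universal C⋆-seminorm on the free ⋆-algebra: the supremum of all C⋆-seminorms vanishing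
on the relations (a finite supremum, by `CovSeminorm.bounded`). -/
def univNorm (w : Word V H) : ℝ := ⨆ p : CovSeminorm V H, p.1 w

theorem le_univNorm (p : CovSeminorm V H) (w : Word V H) : p.1 w ≤ univNorm w :=
  le_ciSup (CovSeminorm.bounded w) p

theorem univNorm_le {w : Word V H} {M : ℝ} (h : ∀ p : CovSeminorm V H, p.1 w ≤ M) :
    univNorm w ≤ M :=
  ciSup_le h

theorem univNorm_nonneg (w : Word V H) : 0 ≤ univNorm w :=
  (apply_nonneg (default : CovSeminorm V H).1 w).trans (le_univNorm _ w)

/-- The universal C⋆-seminorm, as a ring seminorm. -/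
def universalSeminorm (V H : PosCone Γ → A →ₚ[ℂ] A) : RingSeminorm (Word V H) where
  toFun w := univNorm w
  map_zero' := by simp [univNorm]
  add_le' v w := univNorm_le fun p =>
    (map_add_le_add p.1 v w).trans (add_le_add (le_univNorm p v) (le_univNorm p w))
  neg' w := by simp [univNorm]
  mul_le' v w := univNorm_le fun p => (p.2.mul_le v w).trans
    (mul_le_mul (le_univNorm p v) (le_univNorm p w) (apply_nonneg _ _) (univNorm_nonneg v))

instance : SeminormedRing (Word V H) := (universalSeminorm V H).toSeminormedRing

theorem norm_def (w : Word V H) : ‖w‖ = ⨆ p : CovSeminorm V H, p.1 w := rfl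

theorem le_norm (p : CovSeminorm V H) (w : Word V H) : p.1 w ≤ ‖w‖ := le_univNorm p w

theorem norm_le {w : Word V H} {M : ℝ} (h : ∀ p : CovSeminorm V H, p.1 w ≤ M) : ‖w‖ ≤ M :=
  univNorm_le h

theorem norm_smul_le' (c : ℂ) (w : Word V H) : ‖c • w‖ ≤ ‖c‖ * ‖w‖ :=
  norm_le fun p => by
    rw [map_smul_eq_mul]
    exact mul_le_mul_of_nonneg_left (le_norm p w) (norm_nonneg c)

instance : NormedSpace ℂ (Word V H) where
  norm_smul_le := norm_smul_le'

theorem norm_star' (w : Word V H) : ‖star w‖ = ‖w‖ := by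
  simp only [norm_def, CovSeminorm.map_star]

theorem norm_star_mul_self' (w : Word V H) : ‖star w * w‖ = ‖w‖ * ‖w‖ := by
  refine le_antisymm ((norm_mul_le _ _).trans_eq (by rw [norm_star'])) ?_
  have h : ‖w‖ ≤ √‖star w * w‖ := norm_le fun p => by
    apply Real.le_sqrt_of_sq_le
    rw [← p.2.cstar]
    exact le_norm p _
  exact (mul_self_le_mul_self (norm_nonneg w) h).trans_eq (Real.mul_self_sqrt (norm_nonneg _))

theorem isometry_star : Isometry (star : Word V H → Word V H) :=
  AddMonoidHomClass.isometry_of_norm (starAddEquiv : Word V H ≃+ Word V H) norm_star'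

end Word

/-- The crossed product: the Hausdorff completion of the free ⋆-algebra with respect
to the universal C⋆-seminorm. -/
def CrossedProduct (V H : PosCone Γ → A →ₚ[ℂ] A) : Type (max u v) :=
  UniformSpace.Completion (Word V H)

namespace CrossedProduct

open UniformSpace

instance : NormedRing (CrossedProduct V H) := inferInstanceAs (NormedRing (Completion (Word V H)))

instance : CompleteSpace (CrossedProduct V H) :=
  inferInstanceAs (CompleteSpace (Completion (Word V H)))

instance : Algebra ℂ (CrossedProduct V H) :=
  inferInstanceAs (Algebra ℂ (Completion (Word V H)))

instance : NormedAlgebra ℂ (CrossedProduct V H) where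
  norm_smul_le := norm_smul_le (α := ℂ) (β := Completion (Word V H))

/-- The canonical homomorphism from the free ⋆-algebra to its completion. -/
def mk : Word V H →ₐ[ℂ] CrossedProduct V H where
  toFun w := (w : Completion (Word V H))
  map_one' := Completion.coe_one (Word V H)
  map_mul' := Completion.coe_mul
  map_zero' := Completion.coe_zero
  map_add' := Completion.coe_add
  commutes' _ := rfl

theorem denseRange_mk : DenseRange (mk : Word V H → CrossedProduct V H) :=
  Completion.denseRange_coe

theorem continuous_mk : Continuous (mk : Word V H → CrossedProduct V H) :=
  Completion.continuous_coe (Word V H)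

@[simp] theorem norm_mk (w : Word V H) : ‖(mk w : CrossedProduct V H)‖ = ‖w‖ :=
  Completion.norm_coe w

/-- The adjoint on the crossed product: the continuous extension of the adjoint on the free
⋆-algebra. -/
instance : Star (CrossedProduct V H) :=
  ⟨fun b => Completion.map (star : Word V H → Word V H) b⟩

theorem star_mk (w : Word V H) : star (mk w : CrossedProduct V H) = mk (star w) :=
  Completion.map_coe isometry_star.uniformContinuous w

theorem continuous_star' : Continuous (star : CrossedProduct V H → CrossedProduct V H) :=
  Completion.continuous_map

instance : StarRing (CrossedProduct V H) where
  star_involutive b := by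
    refine denseRange_mk.induction_on (p := fun b => star (star b) = b) b
      (isClosed_eq (continuous_star'.comp continuous_star') continuous_id) fun w => ?_
    simp [star_mk]
  star_mul b c := by
    refine denseRange_mk.induction_on₂ (p := fun b c => star (b * c) = star c * star b)
      (isClosed_eq (continuous_star'.comp continuous_mul) ((continuous_star'.comp
        continuous_snd).mul (continuous_star'.comp continuous_fst))) (fun v w => ?_) b c
    rw [← map_mul, star_mk, star_mk, star_mk, star_mul, map_mul]
  star_add b c := by
    refine denseRange_mk.induction_on₂ (p := fun b c => star (b + c) = star b + star c)
      (isClosed_eq (continuous_star'.comp continuous_add) ((continuous_star'.comp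
        continuous_fst).add (continuous_star'.comp continuous_snd))) (fun v w => ?_) b c
    rw [← map_add, star_mk, star_mk, star_mk, star_add, map_add]

instance : CStarRing (CrossedProduct V H) where
  norm_mul_self_le b := by
    refine denseRange_mk.induction_on (p := fun b => ‖b‖ * ‖b‖ ≤ ‖star b * b‖) b
      (isClosed_le (continuous_norm.mul continuous_norm)
        (continuous_norm.comp (continuous_star'.mul continuous_id))) fun w => ?_
    rw [star_mk, ← map_mul, norm_mk, norm_mk, norm_star_mul_self']

instance : StarModule ℂ (CrossedProduct V H) where
  star_smul c b := by
    refine denseRange_mk.induction_on (p := fun b => star (c • b) = star c • star b) b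
      (isClosed_eq (continuous_star'.comp (continuous_const_smul c))
        (continuous_star'.const_smul (star c))) fun w => ?_
    rw [← map_smul, star_mk, star_mk, star_smul, map_smul]

instance : CStarAlgebra (CrossedProduct V H) where

theorem mk_eq_of_rel {v w : Word V H} (h : Rel V H v w) :
    (mk v : CrossedProduct V H) = mk w := by
  rw [← sub_eq_zero, ← norm_eq_zero, ← map_sub, norm_mk]
  exact le_antisymm (norm_le fun p => (p.2.rel v w h).le) (norm_nonneg _)

/-- The canonical unital ⋆-homomorphism of `A` into the crossed product. -/
def ι (V H : PosCone Γ → A →ₚ[ℂ] A) : A →⋆ₐ[ℂ] CrossedProduct V H where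
  toFun b := mk (ofA V H b)
  map_one' := by rw [mk_eq_of_rel Rel.one, map_one]
  map_mul' b c := by rw [mk_eq_of_rel (Rel.mul b c), map_mul]
  map_zero' := by
    have := mk_eq_of_rel (Rel.smul (V := V) (H := H) 0 0)
    rw [zero_smul, zero_smul, map_zero] at this
    exact this
  map_add' b c := by rw [mk_eq_of_rel (Rel.add b c), map_add]
  commutes' z := by
    rw [Algebra.algebraMap_eq_smul_one, mk_eq_of_rel (Rel.smul z 1), map_smul,
      mk_eq_of_rel Rel.one, map_one, Algebra.algebraMap_eq_smul_one]
  map_star' b := by rw [mk_eq_of_rel (Rel.star b), star_mk]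

/-- The canonical partial isometries `Ûₓ` in the crossed product. -/
def U (V H : PosCone Γ → A →ₚ[ℂ] A) (x : PosCone Γ) : CrossedProduct V H := mk (ofU V H x)

/-- The ⋆-subalgebra `C₀` generated by `A` and the `Ûₓ`. -/
def C₀ (V H : PosCone Γ → A →ₚ[ℂ] A) : StarSubalgebra ℂ (CrossedProduct V H) :=
  StarAlgebra.adjoin ℂ (Set.range (ι V H) ∪ Set.range (U V H))

/-! ### Monomials, quasi-monomials and presentations -/

/-- `m` is a monomial `a₁ Û_{x₁} a₂ ⋯ aₙ Û_{xₙ}`, `n ≥ 1`, of positive type and of degree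
`x = x₁ + ⋯ + xₙ`. -/
def IsPosMonomial (x : PosCone Γ) (m : CrossedProduct V H) : Prop :=
  ∃ l : List (A × PosCone Γ), l ≠ [] ∧ (l.map Prod.snd).sum = x ∧
    m = (l.map fun y => ι V H y.1 * U V H y.2).prod

/-- `m` is a monomial `a₁ Û_{x₁}⋆ a₂ ⋯ aₙ Û_{xₙ}⋆`, `n ≥ 1`, of negative type and of degree
`x = x₁ + ⋯ + xₙ`. -/
def IsNegMonomial (x : PosCone Γ) (m : CrossedProduct V H) : Prop :=
  ∃ l : List (A × PosCone Γ), l ≠ [] ∧ (l.map Prod.snd).sum = x ∧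
    m = (l.map fun y => ι V H y.1 * star (U V H y.2)).prod

/-- A quasi-monomial of positive type and degree `x`: a finite sum of monomials of positive type
and degree `x`. -/
def IsPosQuasiMonomial (x : PosCone Γ) (q : CrossedProduct V H) : Prop :=
  ∃ (n : ℕ) (m : Fin n → CrossedProduct V H), (∀ i, IsPosMonomial x (m i)) ∧ q = ∑ i, m i

/-- A quasi-monomial of negative type and degree `x`: a finite sum of monomials of negative type
and degree `x`. -/
def IsNegQuasiMonomial (x : PosCone Γ) (q : CrossedProduct V H) : Prop :=
  ∃ (n : ℕ) (m : Fin n → CrossedProduct V H), (∀ i, IsNegMonomial x (m i)) ∧ q = ∑ i, m i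

/-- A presentation `b = ∑_{x ∈ F} q₋ₓ + a₀ + ∑_{x ∈ F} qₓ` with `F` a finite subset of
`Γ⁺ \ {0}`, quasi-monomials `q₋ₓ`, `qₓ` of degree `x` of negative and positive type, and
`a₀ ∈ A`. -/
structure Presentation (b : CrossedProduct V H) where
  F : Finset (PosCone Γ)
  zero_notMem : 0 ∉ F
  qneg : PosCone Γ → CrossedProduct V H
  qpos : PosCone Γ → CrossedProduct V H
  a₀ : A
  isNeg : ∀ x ∈ F, IsNegQuasiMonomial x (qneg x)
  isPos : ∀ x ∈ F, IsPosQuasiMonomial x (qpos x)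
  eq_sum : b = ∑ x ∈ F, qneg x + ι V H a₀ + ∑ x ∈ F, qpos x

/-- `E` is a conditional expectation of the crossed product onto (the copy of) `A`: a positive
contractive linear projection onto `A` which is an `A`-bimodule map. (Positive elements of a
C⋆-algebra are exactly those of the form `b⋆b`.) -/
structure IsConditionalExpectation (E : CrossedProduct V H →ₗ[ℂ] A) : Prop where
  apply_ι : ∀ c, E (ι V H c) = c
  contractive : ∀ b, ‖E b‖ ≤ ‖b‖
  positive : ∀ b, 0 ≤ E (star b * b)
  bimodule : ∀ c b d, E (ι V H c * b * ι V H d) = c * E b * d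

end CrossedProduct
end CovAlg

end

/-! The crossed product is graded by `Γ` through its gauge action: multiplying each `Ûₓ` by `χ(x)`,
for a character `χ` of the discrete group `Γ`, preserves the defining relations. Elements of `A`
have degree 0, and monomials of degree `x` and positive or negative type have degree `x` or `-x`. So
the theorem says that the degree-zero term is controlled by the whole sum.

The analytic core is `norm_le_norm_add_sum`. Characters separate the points of `Γ`. If `χ(y) ≠ 1`,
the Cesàro means of the powers of the gauge endomorphism of `χ` are contractions that fix degree 0,
send the degree-`y` term to zero in the limit and only rescale the others. Removing the finitely
many non-zero degrees one at a time gives `‖b‖ ≤ ‖b + n‖` for `b` of degree 0 and `n` in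
`offDiagonal`. To compare with the norm of `A` one needs `A` to embed isometrically (`norm_ι`). The
given covariant representation of `V` yields this once `H` is seen to be implemented by the adjoints
(`IsCovariantRep.map_right`), for then it factors through the crossed product.

The algebraic core is `mul_listProd_mem`: since `Γ` is totally ordered, covariance lets a positive
factor cancel against a negative product, or conversely, until one type remains. Hence the span of
`A` and the one-type monomials contains `C₀`, and presentations exist.

Projection to the `A`-component is therefore well defined and contractive on the dense subspace `A +
offDiagonal`. It extends to `E`; the bimodule and adjoint identities pass to the limit, and
positivity follows from contractivity and unitality. -/

set_option linter.unusedSectionVars false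

noncomputable section

namespace CovAlg

/-! ### Uniqueness of the transfer operators in a covariant representation -/

section InteractionOfRep

variable {A : Type u} [CStarAlgebra A] [PartialOrder A] [StarOrderedRing A]
variable {Γ : Type v} [AddCommGroup Γ] [LinearOrder Γ] [IsOrderedAddMonoid Γ]
variable {V H : PosCone Γ → A →ₚ[ℂ] A} {C : Type w} [CStarAlgebra C]
  {σ : A →⋆ₐ[ℂ] C} {u : PosCone Γ → C}

/-- In a covariant representation of `V`, the transfer operators of a complete interaction
`(V, H)` are automatically implemented by the adjoint partial isometries. -/
theorem IsCovariantRep.map_right (h : IsCovariantRep V σ u) (hVH : IsCompleteInteraction V H)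
    (x : PosCone Γ) (a : A) : σ (H x a) = star (u x) * σ a * u x := by
  have hu := h.partialIsometry x
  have hu' : star (u x) * u x * star (u x) = star (u x) := by
    simpa [mul_assoc] using congr_arg star hu
  have hV : ∀ b, σ (V x b) = u x * σ b * star (u x) := h.covariant x
  have hV1 : σ (V x 1) = u x * star (u x) := by simp [hV]
  obtain ⟨p, hp⟩ := h.mem_range x 1
  simp only [map_one, mul_one] at hp
  set e := H x 1 with he
  have hes : star e = e := by
    have : IsSelfAdjoint e := .of_nonneg (map_nonneg (H x) zero_le_one)
    exact this.star_eq
  have hps : star p = p := h.injective (by rw [map_star, hp]; simp)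
  -- Both `V x e` and `V x (e * e)` are mapped by `σ` to `u u⋆`, so `(u σ(e) - u)(u σ(e) - u)⋆`
  -- expands to zero.
  have hue : u x * σ e = u x := by
    have h1 : u x * σ e * star (u x) = u x * star (u x) := by
      rw [← hV, he, hVH.vh]
      simp only [mul_one, map_mul, hV1]
      rw [← mul_assoc, hu]
    have h3 : u x * σ (e * e) * star (u x) = u x * star (u x) := by
      rw [← hV, he]
      have := hVH.v_mul x e e (.inl ⟨1, rfl⟩)
      rw [this, map_mul, hV, h1, ← mul_assoc, hu]
    rw [← sub_eq_zero, ← CStarRing.mul_star_self_eq_zero_iff, star_sub, star_mul, ← map_star, hes]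
    calc (u x * σ e - u x) * (σ e * star (u x) - star (u x))
        = u x * σ (e * e) * star (u x) - u x * σ e * star (u x) - u x * σ e * star (u x)
          + u x * star (u x) := by rw [map_mul]; noncomm_ring
      _ = 0 := by rw [h1, h3]; noncomm_ring
  have hpe : p * e = p := h.injective (by rw [map_mul, hp, mul_assoc, hue])
  have hep : e * p = p := by simpa [hps, hes] using congr_arg star hpe
  have hee : e * e = p := by
    -- `V` kills `1 - p` because `σ p` is the initial projection of `u`; applying `H` gives `e (1 -
    -- p) e = 0`, that is, `e² = p`.
    have h1 : V x (1 - p) = 0 := h.injective (by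
      rw [hV, map_sub, map_one, hp, map_zero, mul_sub, mul_one, ← mul_assoc, hu, sub_self,
        zero_mul])
    have h2 := hVH.hv x (1 - p)
    rw [h1, map_zero, ← he, mul_sub, mul_one, sub_mul, hep, hpe] at h2
    exact (sub_eq_zero.1 h2.symm)
  -- `e = H V H 1 = e³ = p e = p`.
  have hpe' : e = p := by
    have := hVH.hvh x 1
    rw [hVH.hv, ← he, hee, hpe] at this
    exact this.symm
  -- `H x a` lives in the corner cut out by `p`, where conjugation by `u` can be undone; `V H a`
  -- then determines it.
  have h1 : e * H x a * e = H x a := by rw [← hVH.hv, hVH.hvh]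
  have h2 := congr_arg σ (hVH.vh x a)
  simp only [map_mul, hV1] at h2
  rw [hV] at h2
  calc σ (H x a) = star (u x) * (u x * σ (H x a) * star (u x)) * u x := by
        conv_lhs => rw [← h1, hpe', map_mul, map_mul, hp]
        noncomm_ring
    _ = (star (u x) * u x * star (u x)) * σ a * (u x * star (u x) * u x) := by
        rw [h2]; noncomm_ring
    _ = _ := by rw [hu, hu']

end InteractionOfRep

variable {A : Type u} [CStarAlgebra A] [PartialOrder A] [StarOrderedRing A]
variable {Γ : Type v} [AddCommGroup Γ] [LinearOrder Γ] [IsOrderedAddMonoid Γ]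
variable {V H : PosCone Γ → A →ₚ[ℂ] A} {B : Type w} [CStarAlgebra B]

/-! ### The universal property of the crossed product -/

namespace Word

/-- The ⋆-representation of the free algebra determined by images of the generators. -/
def lift (V H : PosCone Γ → A →ₚ[ℂ] A) (σ : A → B) (u : PosCone Γ → B) : Word V H →ₐ[ℂ] B :=
  FreeAlgebra.lift ℂ fun g : Gen A (PosCone Γ) => match g with
    | .ofA b => σ b
    | .ofU x => u x
    | .ofUstar x => star (u x)

@[simp] theorem lift_ofA (σ : A → B) (u : PosCone Γ → B) (b : A) :
    lift V H σ u (ofA V H b) = σ b :=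
  FreeAlgebra.lift_ι_apply _ _

@[simp] theorem lift_ofU (σ : A → B) (u : PosCone Γ → B) (x : PosCone Γ) :
    lift V H σ u (ofU V H x) = u x :=
  FreeAlgebra.lift_ι_apply _ _

theorem lift_ofUstar (σ : A → B) (u : PosCone Γ → B) (x : PosCone Γ) :
    lift V H σ u (of V H (.ofUstar x)) = star (u x) :=
  FreeAlgebra.lift_ι_apply _ _

theorem lift_star (σ : A →⋆ₐ[ℂ] B) (u : PosCone Γ → B) (w : Word V H) :
    lift V H σ u (star w) = star (lift V H σ u w) := by
  induction w using Word.induction with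
  | scalar c => rw [star_algebraMap, AlgHom.commutes, AlgHom.commutes, algebraMap_star_comm]
  | gen g =>
    cases g with
    | ofA b =>
      rw [star_of, starGen]
      exact (lift_ofA _ _ _).trans ((map_star σ b).trans (congr_arg star (lift_ofA _ _ _).symm))
    | ofU x =>
      rw [star_of, starGen, lift_ofUstar]
      exact congr_arg star (lift_ofU _ _ _).symm
    | ofUstar x =>
      rw [star_of, starGen, lift_ofUstar, star_star]
      exact lift_ofU _ _ _
  | mul v w hv hw => simp only [star_mul, map_mul, hv, hw]
  | add v w hv hw => simp only [star_add, map_add, hv, hw]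

end Word

open Word

/-- A representation of the defining relations of the crossed product. -/
structure IsCrossedRep (V H : PosCone Γ → A →ₚ[ℂ] A) (σ : A →⋆ₐ[ℂ] B) (u : PosCone Γ → B) :
    Prop where
  map_add : ∀ x y, u x * u y = u (x + y)
  partialIsometry : ∀ x, u x * star (u x) * u x = u x
  left : ∀ x a, σ (V x a) = u x * σ a * star (u x)
  right : ∀ x a, σ (H x a) = star (u x) * σ a * u x

namespace IsCrossedRep

variable {σ : A →⋆ₐ[ℂ] B} {u : PosCone Γ → B}

theorem lift_eq_of_rel (h : IsCrossedRep V H σ u) {v w : Word V H} (hr : Rel V H v w) :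
    Word.lift V H σ u v = Word.lift V H σ u w := by
  cases hr with
  | add b c => simp
  | smul z b => simp
  | mul b c => simp
  | one => simp
  | star b => simpa [lift_star] using map_star σ b
  | partialIsometry x => simp [lift_star, h.partialIsometry]
  | semigroup x y => simp [h.map_add]
  | left x b => simp [lift_star, h.left]
  | right x b => simp [lift_star, h.right]

/-- The norm pulled back along the representation is one of the C⋆-seminorms over which the
universal one is the supremum. -/
theorem norm_lift_le (h : IsCrossedRep V H σ u) (w : Word V H) :
    ‖Word.lift V H σ u w‖ ≤ ‖w‖ := by
  let p : Seminorm ℂ (Word V H) := (normSeminorm ℂ B).comp (Word.lift V H σ u).toLinearMap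
  have hp : IsCovariantSeminorm p :=
    { mul_le := fun v w => by
        change ‖Word.lift V H σ u (v * w)‖ ≤ _
        rw [map_mul]
        exact norm_mul_le _ _
      cstar := fun w => by
        change ‖Word.lift V H σ u (star w * w)‖ = ‖Word.lift V H σ u w‖ ^ 2
        rw [map_mul, lift_star, CStarRing.norm_star_mul_self, sq]
      rel := fun v w hr => by
        change ‖Word.lift V H σ u (v - w)‖ = 0
        rw [map_sub, h.lift_eq_of_rel hr, sub_self, norm_zero] }
  exact Word.le_norm ⟨p, hp⟩ w

theorem continuous_lift (h : IsCrossedRep V H σ u) : Continuous (Word.lift V H σ u) :=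
  AddMonoidHomClass.continuous_of_bound (Word.lift V H σ u) 1 fun w => by
    simpa using h.norm_lift_le w

open CrossedProduct

/-- The universal property of the crossed product. -/
def lift (h : IsCrossedRep V H σ u) : CrossedProduct V H →⋆ₐ[ℂ] B :=
  let f : CrossedProduct V H →+* B :=
    UniformSpace.Completion.extensionHom (Word.lift V H σ u).toRingHom h.continuous_lift
  have hf : Continuous f := UniformSpace.Completion.continuous_extension
  have hfm : ∀ w, f (CrossedProduct.mk w) = Word.lift V H σ u w := fun w =>
    UniformSpace.Completion.extensionHom_coe _ h.continuous_lift w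
  { f with
    commutes' := fun c => by
      change f (algebraMap ℂ _ c) = _
      rw [← AlgHom.commutes CrossedProduct.mk, hfm, AlgHom.commutes]
    map_star' := fun b => by
      change f (star b) = star (f b)
      refine denseRange_mk.induction_on (p := fun b => f (star b) = star (f b)) b
        (isClosed_eq (hf.comp continuous_star') (continuous_star.comp hf)) fun w => ?_
      rw [star_mk, hfm, hfm, lift_star] }

theorem lift_mk (h : IsCrossedRep V H σ u) (w : Word V H) : h.lift (CrossedProduct.mk w) = Word.lift V H σ u w :=
  UniformSpace.Completion.extensionHom_coe _ h.continuous_lift w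

@[simp] theorem lift_ι (h : IsCrossedRep V H σ u) (a : A) : h.lift (ι V H a) = σ a :=
  (h.lift_mk _).trans (lift_ofA _ _ _)

@[simp] theorem lift_U (h : IsCrossedRep V H σ u) (x : PosCone Γ) : h.lift (U V H x) = u x :=
  (h.lift_mk _).trans (lift_ofU _ _ _)

end IsCrossedRep

namespace CrossedProduct

theorem isCrossedRep_ι_U : IsCrossedRep V H (ι V H) (U V H) where
  map_add x y := by
    simpa only [map_mul] using! mk_eq_of_rel (Rel.semigroup (V := V) (H := H) x y)
  partialIsometry x := by
    simpa only [map_mul, ← star_mk] using! mk_eq_of_rel (Rel.partialIsometry (V := V) (H := H) x)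
  left x a := by
    simpa only [map_mul, ← star_mk] using! mk_eq_of_rel (Rel.left (V := V) (H := H) x a)
  right x a := by
    simpa only [map_mul, ← star_mk] using! mk_eq_of_rel (Rel.right (V := V) (H := H) x a)

/-- The canonical copy of `A` in the crossed product of a finely representable action is
isometric. -/
theorem norm_ι (hV : IsFinelyRepresentable.{u, v, w} V) (hVH : IsCompleteInteraction V H) (a : A) :
    ‖ι V H a‖ = ‖a‖ := by
  obtain ⟨C, _, σ, u, h⟩ := hV
  have hr : IsCrossedRep V H σ u := ⟨h.map_add, h.partialIsometry, h.covariant, h.map_right hVH⟩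
  refine le_antisymm (NonUnitalStarAlgHom.norm_apply_le _ a) ?_
  rw [← NonUnitalStarAlgHom.norm_map σ h.injective a, ← hr.lift_ι a]
  exact NonUnitalStarAlgHom.norm_apply_le _ _

/-! ### The gauge action and spectral subspaces -/

/-- Every relation containing both `Ûₓ` and its adjoint sees only `|χ(x)|² = 1` as an extra factor,
and the semigroup law is multiplicativity of `χ`. -/
theorem isCrossedRep_gauge (χ : AddChar Γ Circle) :
    IsCrossedRep V H (ι V H) (fun x => (χ x.1 : ℂ) • U V H x) := by
  have hχ (x : Γ) : (χ x : ℂ) * starRingEnd ℂ (χ x : ℂ) = 1 := by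
    rw [Complex.mul_conj, Circle.normSq_coe, Complex.ofReal_one]
  have hc := isCrossedRep_ι_U (V := V) (H := H)
  constructor
  · intro x y
    rw [smul_mul_smul_comm, hc.map_add]
    simp [AddChar.map_add_eq_mul]
  · intro x
    simp only [star_smul, smul_mul_smul_comm, hc.partialIsometry]
    simp [hχ]
  · intro x a
    simp [star_smul, smul_smul, mul_comm _ (χ x.1 : ℂ), hχ, hc.left]
  · intro x a
    simp [star_smul, smul_smul, hχ, hc.right]

/-- The gauge endomorphism `a ↦ a`, `Ûₓ ↦ χ(x) Ûₓ`. -/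
def gauge (V H : PosCone Γ → A →ₚ[ℂ] A) (χ : AddChar Γ Circle) :
    CrossedProduct V H →⋆ₐ[ℂ] CrossedProduct V H :=
  (isCrossedRep_gauge χ).lift

@[simp] theorem gauge_ι (χ : AddChar Γ Circle) (a : A) : gauge V H χ (ι V H a) = ι V H a :=
  IsCrossedRep.lift_ι _ a

@[simp] theorem gauge_U (χ : AddChar Γ Circle) (x : PosCone Γ) :
    gauge V H χ (U V H x) = (χ x.1 : ℂ) • U V H x :=
  IsCrossedRep.lift_U _ x

/-- The elements of degree `g` for the gauge action. -/
def spectral (V H : PosCone Γ → A →ₚ[ℂ] A) (g : Γ) : Submodule ℂ (CrossedProduct V H) :=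
  ⨅ χ : AddChar Γ Circle, LinearMap.eqLocus (gauge V H χ).toLinearMap
    ((χ g : ℂ) • LinearMap.id)

theorem mem_spectral {g : Γ} {b : CrossedProduct V H} :
    b ∈ spectral V H g ↔ ∀ χ : AddChar Γ Circle, gauge V H χ b = (χ g : ℂ) • b := by
  simp [spectral, LinearMap.mem_eqLocus]

theorem ι_mem_spectral (a : A) : ι V H a ∈ spectral V H (0 : Γ) :=
  mem_spectral.2 fun χ => by simp

theorem U_mem_spectral (x : PosCone Γ) : U V H x ∈ spectral V H x.1 :=
  mem_spectral.2 fun χ => by simp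

theorem mul_mem_spectral {g h : Γ} {b c : CrossedProduct V H} (hb : b ∈ spectral V H g)
    (hc : c ∈ spectral V H h) : b * c ∈ spectral V H (g + h) :=
  mem_spectral.2 fun χ => by
    rw [map_mul, mem_spectral.1 hb, mem_spectral.1 hc, smul_mul_smul_comm, AddChar.map_add_eq_mul,
      Circle.coe_mul]

theorem star_mem_spectral {g : Γ} {b : CrossedProduct V H} (hb : b ∈ spectral V H g) :
    star b ∈ spectral V H (-g) :=
  mem_spectral.2 fun χ => by
    rw [map_star, mem_spectral.1 hb, star_smul, AddChar.map_neg_eq_inv, Circle.coe_inv_eq_conj]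
    rfl

end CrossedProduct
end CovAlg

end

/-! ### Averaging over the gauge action -/

noncomputable section

namespace CovAlg

/-- Characters of an abelian group separate its points. -/
theorem exists_addChar_circle_ne_one {G : Type*} [AddCommGroup G] {g : G} (hg : g ≠ 0) :
    ∃ χ : AddChar G Circle, χ g ≠ 1 := by
  obtain ⟨c, hc⟩ := CharacterModule.exists_character_apply_ne_zero_of_ne_zero hg
  -- `CharacterModule` takes values in `ℚ/ℤ`; the map `q ↦ exp(2πiq)` embeds this group in the
  -- circle.
  let f : ℚ →+ Additive Circle :=
    { toFun := fun q => Additive.ofMul (Circle.exp (q * (2 * Real.pi)))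
      map_zero' := by simp
      map_add' := fun p q => by
        rw [← ofMul_mul, ← Circle.exp_add]
        push_cast
        rw [add_mul] }
  let F : AddCircle (1 : ℚ) →+ Additive Circle :=
    QuotientAddGroup.lift _ f (by
      rw [AddSubgroup.zmultiples_le]
      change Circle.exp (((1 : ℚ) : ℝ) * (2 * Real.pi)) = 1
      simp)
  refine ⟨AddChar.toAddMonoidHomEquiv.symm (F.comp c), fun h => hc ?_⟩
  obtain ⟨q, hq⟩ := QuotientAddGroup.mk_surjective (c g)
  have h' : Circle.exp ((q : ℝ) * (2 * Real.pi)) = 1 := by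
    change F (c g) = 0 at h
    rw [← hq] at h
    exact h
  obtain ⟨n, hn⟩ := Circle.exp_eq_one.1 h'
  have hqn : q = n := by
    have := mul_right_cancel₀ Real.two_pi_pos.ne' hn
    exact_mod_cast this
  rw [← hq]
  exact (QuotientAddGroup.eq_zero_iff q).2 ⟨n, by simp [hqn]⟩

variable {A : Type u} [CStarAlgebra A] [PartialOrder A] [StarOrderedRing A]
variable {Γ : Type v} [AddCommGroup Γ] [LinearOrder Γ] [IsOrderedAddMonoid Γ]
variable {V H : PosCone Γ → A →ₚ[ℂ] A}

namespace CrossedProduct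

/-- The Cesàro means of the powers of a gauge endomorphism. -/
def gaugeMean (V H : PosCone Γ → A →ₚ[ℂ] A) (χ : AddChar Γ Circle) (n : ℕ) :
    CrossedProduct V H →ₗ[ℂ] CrossedProduct V H :=
  (n : ℂ)⁻¹ • ∑ k ∈ Finset.range n, (gauge V H χ).toLinearMap ^ k

theorem norm_gauge_pow_le (χ : AddChar Γ Circle) (k : ℕ) (b : CrossedProduct V H) :
    ‖((gauge V H χ).toLinearMap ^ k) b‖ ≤ ‖b‖ := by
  induction k with
  | zero => simp
  | succ k ih =>
    rw [pow_succ', Module.End.mul_apply]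
    exact (NonUnitalStarAlgHom.norm_apply_le (gauge V H χ) _).trans ih

theorem norm_gaugeMean_le (χ : AddChar Γ Circle) (n : ℕ) (b : CrossedProduct V H) :
    ‖gaugeMean V H χ n b‖ ≤ ‖b‖ := by
  rw [gaugeMean, LinearMap.smul_apply, LinearMap.sum_apply, norm_smul, norm_inv,
    Complex.norm_natCast]
  rcases n.eq_zero_or_pos with rfl | hn
  · simp
  rw [inv_mul_le_iff₀ (by exact_mod_cast hn)]
  refine (norm_sum_le_of_le _ fun k _ => norm_gauge_pow_le χ k b).trans ?_
  simp

theorem gaugeMean_apply (χ : AddChar Γ Circle) (n : ℕ) {g : Γ} {b : CrossedProduct V H}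
    (hb : b ∈ spectral V H g) :
    gaugeMean V H χ n b = ((n : ℂ)⁻¹ * ∑ k ∈ Finset.range n, (χ g : ℂ) ^ k) • b := by
  have h (k : ℕ) : ((gauge V H χ).toLinearMap ^ k) b = (χ g : ℂ) ^ k • b := by
    induction k with
    | zero => simp
    | succ k ih =>
      rw [pow_succ', Module.End.mul_apply, ih, map_smul, pow_succ', mul_comm, mul_smul]
      exact congr_arg _ (mem_spectral.1 hb χ)
  simp only [gaugeMean, LinearMap.smul_apply, LinearMap.sum_apply, h, ← Finset.sum_smul, smul_smul]

/-- The geometric sums stay bounded by `2 / ‖z - 1‖`. -/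
theorem tendsto_mean_pow {z : ℂ} (hz : ‖z‖ = 1) (hz1 : z ≠ 1) :
    Filter.Tendsto (fun n : ℕ => (n : ℂ)⁻¹ * ∑ k ∈ Finset.range n, z ^ k) Filter.atTop
      (nhds 0) := by
  refine squeeze_zero_norm (a := fun n : ℕ => (n : ℝ)⁻¹ * (2 / ‖z - 1‖)) (fun n => ?_) ?_
  · rw [norm_mul, norm_inv, Complex.norm_natCast, geom_sum_eq hz1, norm_div]
    gcongr
    refine (norm_sub_le _ _).trans ?_
    rw [norm_pow, hz]
    norm_num
  · simpa using tendsto_inv_atTop_nhds_zero_nat.mul_const (2 / ‖z - 1‖)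

/-- Induction on the number of degrees. A contractive mean that fixes `b` makes the degree-`y` term
arbitrarily small; the remaining terms are merely rescaled, which is harmless because the induction
hypothesis holds for all coefficients `f`. -/
theorem norm_le_norm_add_sum (s : Finset Γ) (hs : 0 ∉ s) (f : Γ → CrossedProduct V H)
    (hf : ∀ g ∈ s, f g ∈ spectral V H g) {b : CrossedProduct V H} (hb : b ∈ spectral V H (0 : Γ)) :
    ‖b‖ ≤ ‖b + ∑ g ∈ s, f g‖ := by
  induction s using Finset.induction_on generalizing f with
  | empty => simp
  | insert y s hy ih =>
    obtain ⟨χ, hχ⟩ := exists_addChar_circle_ne_one (g := y) fun h => hs (by simp [h])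
    let c (n : ℕ) (g : Γ) : ℂ := (n : ℂ)⁻¹ * ∑ k ∈ Finset.range n, (χ g : ℂ) ^ k
    have hc : Filter.Tendsto (fun n => c n y) Filter.atTop (nhds 0) :=
      tendsto_mean_pow (Circle.norm_coe _) fun h => hχ (Circle.ext h)
    -- Positivity of `n` matters: the mean for `n = 0` is the zero map and does not fix `b`.
    have key : ∀ n : ℕ, 0 < n → ‖b‖ ≤ ‖b + ∑ g ∈ insert y s, f g‖ + ‖c n y‖ * ‖f y‖ := by
      intro n hn
      have hn' : (n : ℂ) ≠ 0 := by exact_mod_cast hn.ne'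
      have h1 := ih (fun h => hs (Finset.mem_insert_of_mem h)) (fun g => c n g • f g)
        fun g hg => Submodule.smul_mem _ _ (hf g (Finset.mem_insert_of_mem hg))
      have h2 : gaugeMean V H χ n (b + ∑ g ∈ insert y s, f g)
          = b + ∑ g ∈ insert y s, c n g • f g := by
        rw [map_add, map_sum, gaugeMean_apply χ n hb,
          Finset.sum_congr rfl fun g hg => gaugeMean_apply χ n (hf g hg)]
        simp [hn', c]
      have h3 : b + ∑ g ∈ s, c n g • f g =
          gaugeMean V H χ n (b + ∑ g ∈ insert y s, f g) - c n y • f y := by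
        rw [h2, Finset.sum_insert hy]
        abel
      rw [h3] at h1
      refine h1.trans ((norm_sub_le _ _).trans ?_)
      rw [norm_smul]
      gcongr
      exact norm_gaugeMean_le _ _ _
    refine ge_of_tendsto (x := Filter.atTop)
      (f := fun n => ‖b + ∑ g ∈ insert y s, f g‖ + ‖c n y‖ * ‖f y‖) ?_
      (Filter.eventually_atTop.2 ⟨1, key⟩)
    simpa using (hc.norm.mul_const ‖f y‖).const_add ‖b + ∑ g ∈ insert y s, f g‖

/-- The span of the homogeneous elements of non-zero degree. -/
def offDiagonal (V H : PosCone Γ → A →ₚ[ℂ] A) : Submodule ℂ (CrossedProduct V H) :=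
  ⨆ g : {g : Γ // g ≠ 0}, spectral V H g.1

theorem spectral_le_offDiagonal {g : Γ} (hg : g ≠ 0) : spectral V H g ≤ offDiagonal V H :=
  le_iSup (fun g : {g : Γ // g ≠ 0} => spectral V H g.1) ⟨g, hg⟩

theorem norm_le_norm_add_offDiagonal {b n : CrossedProduct V H} (hb : b ∈ spectral V H (0 : Γ))
    (hn : n ∈ offDiagonal V H) : ‖b‖ ≤ ‖b + n‖ := by
  classical
  obtain ⟨f, hf, rfl⟩ := (Submodule.mem_iSup_iff_exists_finsupp _ _).1 hn
  -- The family is indexed by non-zero degrees only and is extended by zero to all of `Γ`.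
  have := norm_le_norm_add_sum (V := V) (H := H) (f.support.map (Function.Embedding.subtype _))
    (by simp) (fun g => if h : g ≠ 0 then f ⟨g, h⟩ else 0) (fun g hg => by
      have hg0 : g ≠ 0 := by
        obtain ⟨g', -, rfl⟩ := Finset.mem_map.1 hg
        exact g'.2
      rw [dif_pos hg0]
      exact hf ⟨g, hg0⟩) hb
  refine this.trans_eq ?_
  rw [Finset.sum_map, Finsupp.sum]
  congr 2
  exact Finset.sum_congr rfl fun g _ => dif_pos g.2

theorem star_mem_offDiagonal {n : CrossedProduct V H} (hn : n ∈ offDiagonal V H) :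
    star n ∈ offDiagonal V H := by
  refine Submodule.iSup_induction _ (motive := fun n => star n ∈ offDiagonal V H) hn
    (fun g b hb => ?_) (by simp) fun b c hb hc => ?_
  · exact spectral_le_offDiagonal (neg_ne_zero.2 g.2) (star_mem_spectral hb)
  · rw [star_add]
    exact add_mem hb hc

theorem ι_mul_mul_ι_mem_offDiagonal {n : CrossedProduct V H} (hn : n ∈ offDiagonal V H) (c d : A) :
    ι V H c * n * ι V H d ∈ offDiagonal V H := by
  refine Submodule.iSup_induction _
    (motive := fun n => ι V H c * n * ι V H d ∈ offDiagonal V H) hn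
    (fun g b hb => ?_) (by simp) fun b c hb hc => ?_
  · refine spectral_le_offDiagonal g.2 ?_
    have := mul_mem_spectral (mul_mem_spectral (ι_mem_spectral c) hb) (ι_mem_spectral d)
    rwa [zero_add, add_zero] at this
  · rw [mul_add, add_mul]
    exact add_mem hb hc

/-! ### Monomials -/

/-- The product `a₁ p(x₁) ⋯ aₙ p(xₙ)`. -/
def listProd (p : PosCone Γ → CrossedProduct V H) (l : List (A × PosCone Γ)) :
    CrossedProduct V H :=
  (l.map fun y => ι V H y.1 * p y.2).prod

@[simp] theorem listProd_nil (p : PosCone Γ → CrossedProduct V H) : listProd p [] = 1 := rfl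

@[simp] theorem listProd_cons (p : PosCone Γ → CrossedProduct V H) (y : A × PosCone Γ)
    (l : List (A × PosCone Γ)) : listProd p (y :: l) = ι V H y.1 * p y.2 * listProd p l := by
  simp [listProd]

/-- Taking `φ` to be the identity or negation covers both types of monomial. -/
theorem listProd_mem_spectral {p : PosCone Γ → CrossedProduct V H} {φ : Γ →+ Γ}
    (hp : ∀ x, p x ∈ spectral V H (φ x.1)) (l : List (A × PosCone Γ)) :
    listProd p l ∈ spectral V H (φ (l.map Prod.snd).sum.1) := by
  induction l with
  | nil => simpa using ι_mem_spectral (V := V) (H := H) 1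
  | cons y l ih =>
    have := mul_mem_spectral (mul_mem_spectral (ι_mem_spectral y.1) (hp y.2)) ih
    rw [zero_add, ← map_add] at this
    simpa using this

theorem IsPosMonomial.mem_spectral {x : PosCone Γ} {m : CrossedProduct V H}
    (hm : IsPosMonomial x m) : m ∈ spectral V H x.1 := by
  obtain ⟨l, -, rfl, rfl⟩ := hm
  exact listProd_mem_spectral (φ := AddMonoidHom.id Γ) U_mem_spectral l

theorem IsNegMonomial.mem_spectral {x : PosCone Γ} {m : CrossedProduct V H}
    (hm : IsNegMonomial x m) : m ∈ spectral V H (-x.1) := by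
  obtain ⟨l, -, rfl, rfl⟩ := hm
  exact listProd_mem_spectral (p := fun x => star (U V H x)) (φ := negAddMonoidHom)
    (fun x => star_mem_spectral (U_mem_spectral x)) l

/-- As `0 ∉ F`, all quasi-monomials have non-zero degree `x` or `-x`. The norm estimate and
uniqueness use presentations only through this fact. -/
theorem Presentation.sub_mem_offDiagonal {b : CrossedProduct V H} (P : Presentation b) :
    b - ι V H P.a₀ ∈ offDiagonal V H := by
  have h0 : ∀ x ∈ P.F, x.1 ≠ 0 := fun x hx h =>
    P.zero_notMem (by rwa [show x = 0 from Subtype.ext h] at hx)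
  have h1 : b - ι V H P.a₀ = ∑ x ∈ P.F, P.qneg x + ∑ x ∈ P.F, P.qpos x :=
    (congr_arg (· - ι V H P.a₀) P.eq_sum).trans (by abel)
  rw [h1]
  refine add_mem (sum_mem fun x hx => ?_) (sum_mem fun x hx => ?_)
  · obtain ⟨n, m, hm, hq⟩ := P.isNeg x hx
    rw [hq]
    exact sum_mem fun i _ => spectral_le_offDiagonal (neg_ne_zero.2 (h0 x hx)) (hm i).mem_spectral
  · obtain ⟨n, m, hm, hq⟩ := P.isPos x hx
    rw [hq]
    exact sum_mem fun i _ => spectral_le_offDiagonal (h0 x hx) (hm i).mem_spectral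

/-! ### Existence of presentations -/

/-- Non-negative degrees with sum zero all vanish, so only the coefficients survive. Monomials of
degree 0 must go into `a₀`, since `F` omits 0. -/
theorem listProd_mem_range_ι {p : PosCone Γ → CrossedProduct V H} (hp : p 0 = 1)
    {l : List (A × PosCone Γ)} (hl : (l.map Prod.snd).sum = 0) :
    ∃ a, ι V H a = listProd p l := by
  induction l with
  | nil => exact ⟨1, map_one _⟩
  | cons y l ih =>
    rw [List.map_cons, List.sum_cons] at hl
    have h := (add_eq_zero_iff_of_nonneg y.2.2 (l.map Prod.snd).sum.2).1
      (congr_arg Subtype.val hl)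
    obtain ⟨a, ha⟩ := ih (Subtype.ext h.2)
    exact ⟨y.1 * a, by rw [listProd_cons, show y.2 = 0 from Subtype.ext h.1, hp, map_mul, ha,
      mul_one]⟩

/-- A finite sum of products `a₁ p(x₁) ⋯ aₙ p(xₙ)`, `n ≥ 1`, of degree `x`. -/
def IsListSum (p : PosCone Γ → CrossedProduct V H) (x : PosCone Γ) (q : CrossedProduct V H) :
    Prop :=
  ∃ (n : ℕ) (m : Fin n → CrossedProduct V H), (∀ i, ∃ l : List (A × PosCone Γ), l ≠ [] ∧
    (l.map Prod.snd).sum = x ∧ m i = listProd p l) ∧ q = ∑ i, m i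

theorem IsListSum.zero (p : PosCone Γ → CrossedProduct V H) (x : PosCone Γ) : IsListSum p x 0 :=
  ⟨0, Fin.elim0, fun i => i.elim0, by simp⟩

theorem IsListSum.single (p : PosCone Γ → CrossedProduct V H) {l : List (A × PosCone Γ)}
    (hl : l ≠ []) : IsListSum p (l.map Prod.snd).sum (listProd p l) :=
  ⟨1, fun _ => listProd p l, fun _ => ⟨l, hl, rfl, rfl⟩, by simp⟩

theorem IsListSum.add {p : PosCone Γ → CrossedProduct V H} {x : PosCone Γ}
    {q r : CrossedProduct V H} (hq : IsListSum p x q) (hr : IsListSum p x r) :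
    IsListSum p x (q + r) := by
  obtain ⟨n, m, hm, rfl⟩ := hq
  obtain ⟨n', m', hm', rfl⟩ := hr
  exact ⟨n + n', Fin.append m m', Fin.addCases (by simpa using hm) (by simpa using hm'),
    by simp [Fin.sum_univ_add]⟩

theorem IsListSum.smul {p : PosCone Γ → CrossedProduct V H} {x : PosCone Γ}
    {q : CrossedProduct V H} (c : ℂ) (hq : IsListSum p x q) : IsListSum p x (c • q) := by
  obtain ⟨n, m, hm, rfl⟩ := hq
  refine ⟨n, fun i => c • m i, fun i => ?_, Finset.smul_sum⟩
  obtain ⟨l, hl, hx, hmi⟩ := hm i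
  cases l with
  | nil => exact absurd rfl hl
  | cons y l =>
    -- The scalar is absorbed by the first coefficient, which exists because the list is non-empty.
    refine ⟨(c • y.1, y.2) :: l, by simp, by simpa using hx, ?_⟩
    simp [hmi]

theorem isListSum_U {x : PosCone Γ} {q : CrossedProduct V H} :
    IsListSum (U V H) x q ↔ IsPosQuasiMonomial x q := Iff.rfl

theorem isListSum_star_U {x : PosCone Γ} {q : CrossedProduct V H} :
    IsListSum (fun x => star (U V H x)) x q ↔ IsNegQuasiMonomial x q := Iff.rfl

namespace Presentation

/-- The sum of two presentations. -/
theorem exists_add {b c : CrossedProduct V H} (P : Presentation b) (Q : Presentation c) :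
    Nonempty (Presentation (b + c)) := by
  classical
  -- Outside its index set a presentation carries arbitrary values, so they are replaced by zero
  -- before adding over the union.
  have h (p : PosCone Γ → CrossedProduct V H) {F : Finset (PosCone Γ)}
      {q : PosCone Γ → CrossedProduct V H} (hq : ∀ x ∈ F, IsListSum p x (q x))
      (x : PosCone Γ) : IsListSum p x (if x ∈ F then q x else 0) := by
    split_ifs with hx
    exacts [hq x hx, .zero p x]
  have hs {F G : Finset (PosCone Γ)} (hFG : F ⊆ G) (q : PosCone Γ → CrossedProduct V H) :
      ∑ x ∈ G, (if x ∈ F then q x else 0) = ∑ x ∈ F, q x := by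
    rw [Finset.sum_ite_mem, Finset.inter_eq_right.2 hFG]
  exact ⟨{
    F := P.F ∪ Q.F
    zero_notMem := by simp [P.zero_notMem, Q.zero_notMem]
    qneg := fun x => (if x ∈ P.F then P.qneg x else 0) + (if x ∈ Q.F then Q.qneg x else 0)
    qpos := fun x => (if x ∈ P.F then P.qpos x else 0) + (if x ∈ Q.F then Q.qpos x else 0)
    a₀ := P.a₀ + Q.a₀
    isNeg := fun x _ => isListSum_star_U.1 <|
      (h _ (fun x hx => isListSum_star_U.2 (P.isNeg x hx)) x).add
        (h _ (fun x hx => isListSum_star_U.2 (Q.isNeg x hx)) x)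
    isPos := fun x _ => isListSum_U.1 <|
      (h _ (fun x hx => isListSum_U.2 (P.isPos x hx)) x).add
        (h _ (fun x hx => isListSum_U.2 (Q.isPos x hx)) x)
    eq_sum := by
      simp only [Finset.sum_add_distrib, hs Finset.subset_union_left,
        hs Finset.subset_union_right, map_add]
      exact (congr_arg₂ (· + ·) P.eq_sum Q.eq_sum).trans (by abel) }⟩

theorem exists_smul {b : CrossedProduct V H} (c : ℂ) (P : Presentation b) :
    Nonempty (Presentation (c • b)) :=
  ⟨{
    F := P.F
    zero_notMem := P.zero_notMem
    qneg := fun x => c • P.qneg x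
    qpos := fun x => c • P.qpos x
    a₀ := c • P.a₀
    isNeg := fun x hx => isListSum_star_U.1 ((isListSum_star_U.2 (P.isNeg x hx)).smul c)
    isPos := fun x hx => isListSum_U.1 ((isListSum_U.2 (P.isPos x hx)).smul c)
    eq_sum := by
      conv_lhs => rw [P.eq_sum]
      simp only [smul_add, Finset.smul_sum, map_smul] }⟩

theorem exists_ι (a : A) : Nonempty (Presentation (ι V H a)) :=
  ⟨{
    F := ∅
    zero_notMem := by simp
    qneg := 0
    qpos := 0
    a₀ := a
    isNeg := by simp
    isPos := by simp
    eq_sum := by simp }⟩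

theorem exists_listProd_U (hU : U V H 0 = 1) {l : List (A × PosCone Γ)} (hl : l ≠ []) :
    Nonempty (Presentation (listProd (U V H) l)) := by
  by_cases h0 : (l.map Prod.snd).sum = 0
  · obtain ⟨a, ha⟩ := listProd_mem_range_ι hU h0
    exact ha ▸ exists_ι a
  exact ⟨{
    F := {(l.map Prod.snd).sum}
    zero_notMem := by simpa using Ne.symm h0
    qneg := 0
    qpos := fun _ => listProd (U V H) l
    a₀ := 0
    isNeg := fun x _ => isListSum_star_U.1 (.zero _ x)
    isPos := fun x hx => by
      rw [Finset.mem_singleton.1 hx]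
      exact isListSum_U.1 (.single _ hl)
    eq_sum := by simp }⟩

theorem exists_listProd_star_U (hU : U V H 0 = 1) {l : List (A × PosCone Γ)} (hl : l ≠ []) :
    Nonempty (Presentation (listProd (fun x => star (U V H x)) l)) := by
  by_cases h0 : (l.map Prod.snd).sum = 0
  · obtain ⟨a, ha⟩ := listProd_mem_range_ι (p := fun x => star (U V H x)) (by simp [hU]) h0
    exact ha ▸ exists_ι a
  exact ⟨{
    F := {(l.map Prod.snd).sum}
    zero_notMem := by simpa using Ne.symm h0
    qneg := fun _ => listProd (fun x => star (U V H x)) l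
    qpos := 0
    a₀ := 0
    isNeg := fun x hx => by
      rw [Finset.mem_singleton.1 hx]
      exact isListSum_star_U.1 (.single _ hl)
    isPos := fun x _ => isListSum_U.1 (.zero _ x)
    eq_sum := by simp }⟩

end Presentation

/-! ### Reduction of mixed products to monomials of one type -/

/-- The span of `A` and all monomials of positive and of negative type. -/
def monomialSpan (V H : PosCone Γ → A →ₚ[ℂ] A) : Submodule ℂ (CrossedProduct V H) :=
  Submodule.span ℂ (Set.range (ι V H) ∪ (listProd (U V H) '' {l | l ≠ []} ∪
    listProd (fun x => star (U V H x)) '' {l | l ≠ []}))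

theorem ι_mem_monomialSpan (a : A) : ι V H a ∈ monomialSpan V H :=
  Submodule.subset_span (.inl ⟨a, rfl⟩)

theorem listProd_U_mem_monomialSpan (l : List (A × PosCone Γ)) (hl : l ≠ []) :
    listProd (U V H) l ∈ monomialSpan V H :=
  Submodule.subset_span (.inr (.inl ⟨l, hl, rfl⟩))

theorem listProd_star_U_mem_monomialSpan (l : List (A × PosCone Γ)) (hl : l ≠ []) :
    listProd (fun x => star (U V H x)) l ∈ monomialSpan V H :=
  Submodule.subset_span (.inr (.inr ⟨l, hl, rfl⟩))

/-- `𝒱₀ = Id` makes `Û₀` a coisometry, and an idempotent with a right inverse is 1. -/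
theorem U_zero (hVH : IsCompleteInteraction V H) : U V H 0 = 1 := by
  have h := isCrossedRep_ι_U (V := V) (H := H)
  have h1 : U V H 0 * star (U V H 0) = 1 := by
    have := h.left 0 1
    rw [hVH.left.map_zero] at this
    simpa using this.symm
  calc U V H 0 = U V H 0 * (U V H 0 * star (U V H 0)) := by rw [h1, mul_one]
    _ = 1 := by rw [← mul_assoc, h.map_add, add_zero, h1]

theorem exists_presentation_of_mem_monomialSpan (hVH : IsCompleteInteraction V H)
    {b : CrossedProduct V H} (hb : b ∈ monomialSpan V H) : Nonempty (Presentation b) := by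
  induction hb using Submodule.span_induction with
  | mem b hb =>
    rcases hb with ⟨a, rfl⟩ | ⟨l, hl, rfl⟩ | ⟨l, hl, rfl⟩
    · exact Presentation.exists_ι a
    · exact Presentation.exists_listProd_U (U_zero hVH) hl
    · exact Presentation.exists_listProd_star_U (U_zero hVH) hl
  | zero => simpa using Presentation.exists_ι (V := V) (H := H) 0
  | add b c _ _ hb hc =>
    obtain ⟨P⟩ := hb
    obtain ⟨Q⟩ := hc
    exact P.exists_add Q
  | smul c b _ hb =>
    obtain ⟨P⟩ := hb
    exact P.exists_smul c

/-- The smaller of the two adjacent degrees is cancelled by covariance. Either a shorter `q`-product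
remains to the right of a `p`-factor, or the `p`-factor is used up and a pure `q`-product is left.
The roles `(p, q, W)` are `(Û, Û⋆, 𝒱)` and `(Û⋆, Û, ℋ)`. -/
theorem mul_listProd_mem {p q : PosCone Γ → CrossedProduct V H} {W : PosCone Γ → A → A}
    {T : Submodule ℂ (CrossedProduct V H)} (hp0 : p 0 = 1) (hp : ∀ x y, p x * p y = p (x + y))
    (hq : ∀ x y, q x * q y = q (x + y)) (hW : ∀ x a, p x * ι V H a * q x = ι V H (W x a))
    (hpT : ∀ l, l ≠ [] → listProd p l ∈ T) (hqT : ∀ l, l ≠ [] → listProd q l ∈ T)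
    (l : List (A × PosCone Γ)) (x : PosCone Γ) (a : A) :
    p x * ι V H a * listProd q l ∈ T := by
  induction l generalizing x a with
  -- A monomial must end in a `p`-factor; `p 0 = 1` supplies it.
  | nil => simpa [hp0] using hpT [(1, x), (a, 0)] (by simp)
  | cons y l ih =>
    obtain ⟨c, y⟩ := y
    rcases le_total y x with hyx | hxy
    · obtain ⟨z, rfl⟩ : ∃ z, x = z + y := ⟨⟨x.1 - y.1, sub_nonneg.2 hyx⟩, Subtype.ext (by simp)⟩
      have : p (z + y) * ι V H a * listProd q ((c, y) :: l) =
          p z * (p y * ι V H (a * c) * q y) * listProd q l := by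
        rw [← hp, listProd_cons, map_mul]
        noncomm_ring
      rw [this, hW]
      exact ih _ _
    · obtain ⟨z, rfl⟩ : ∃ z, y = x + z := ⟨⟨y.1 - x.1, sub_nonneg.2 hxy⟩, Subtype.ext (by simp)⟩
      have : p x * ι V H a * listProd q ((c, x + z) :: l) =
          (p x * ι V H (a * c) * q x) * q z * listProd q l := by
        rw [listProd_cons, ← hq, map_mul]
        noncomm_ring
      rw [this, hW]
      exact hqT ((_, z) :: l) (by simp)

theorem mul_mem_monomialSpan {c : CrossedProduct V H}
    (h1 : ∀ a, c * ι V H a ∈ monomialSpan V H)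
    (h2 : ∀ l, l ≠ [] → c * listProd (U V H) l ∈ monomialSpan V H)
    (h3 : ∀ l, l ≠ [] → c * listProd (fun x => star (U V H x)) l ∈ monomialSpan V H)
    {b : CrossedProduct V H} (hb : b ∈ monomialSpan V H) : c * b ∈ monomialSpan V H := by
  induction hb using Submodule.span_induction with
  | mem b hb =>
    rcases hb with ⟨a, rfl⟩ | ⟨l, hl, rfl⟩ | ⟨l, hl, rfl⟩
    exacts [h1 a, h2 l hl, h3 l hl]
  | zero => simp
  | add b d _ _ hb hd => simpa [mul_add] using add_mem hb hd
  | smul z b _ hb => simpa using Submodule.smul_mem _ z hb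

theorem ι_mul_listProd (p : PosCone Γ → CrossedProduct V H) (a : A) {l : List (A × PosCone Γ)}
    (hl : l ≠ []) : ∃ l', l' ≠ [] ∧ ι V H a * listProd p l = listProd p l' := by
  cases l with
  | nil => exact absurd rfl hl
  | cons y l => exact ⟨(a * y.1, y.2) :: l, by simp, by simp [mul_assoc]⟩

theorem ι_mul_mem_monomialSpan (a : A) {b : CrossedProduct V H} (hb : b ∈ monomialSpan V H) :
    ι V H a * b ∈ monomialSpan V H := by
  refine mul_mem_monomialSpan (fun c => ?_) (fun l hl => ?_) (fun l hl => ?_) hb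
  · rw [← map_mul]
    exact ι_mem_monomialSpan _
  · obtain ⟨l', hl', h⟩ := ι_mul_listProd (U V H) a hl
    exact h ▸ listProd_U_mem_monomialSpan l' hl'
  · obtain ⟨l', hl', h⟩ := ι_mul_listProd (fun x => star (U V H x)) a hl
    exact h ▸ listProd_star_U_mem_monomialSpan l' hl'

theorem star_U_mul (x y : PosCone Γ) : star (U V H x) * star (U V H y) = star (U V H (x + y)) := by
  rw [← star_mul, isCrossedRep_ι_U.map_add, add_comm]

theorem U_mul_mem_monomialSpan (hVH : IsCompleteInteraction V H) (x : PosCone Γ)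
    {b : CrossedProduct V H} (hb : b ∈ monomialSpan V H) : U V H x * b ∈ monomialSpan V H := by
  have h := isCrossedRep_ι_U (V := V) (H := H)
  have key := mul_listProd_mem (q := fun x => star (U V H x)) (U_zero hVH) h.map_add star_U_mul
    (fun x a => (h.left x a).symm) listProd_U_mem_monomialSpan listProd_star_U_mem_monomialSpan
  refine mul_mem_monomialSpan (fun c => ?_) (fun l hl => ?_) (fun l hl => ?_) hb
  · simpa using key [] x c
  · simpa using listProd_U_mem_monomialSpan ((1, x) :: l) (by simp)
  · simpa using key l x 1

theorem star_U_mul_mem_monomialSpan (hVH : IsCompleteInteraction V H) (x : PosCone Γ)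
    {b : CrossedProduct V H} (hb : b ∈ monomialSpan V H) :
    star (U V H x) * b ∈ monomialSpan V H := by
  have h := isCrossedRep_ι_U (V := V) (H := H)
  have key := mul_listProd_mem (p := fun x => star (U V H x)) (by simp [U_zero hVH]) star_U_mul
    h.map_add (fun x a => (h.right x a).symm) listProd_star_U_mem_monomialSpan
    listProd_U_mem_monomialSpan
  refine mul_mem_monomialSpan (fun c => ?_) (fun l hl => ?_) (fun l hl => ?_) hb
  · simpa using key [] x c
  · simpa using key l x 1
  · simpa using listProd_star_U_mem_monomialSpan ((1, x) :: l) (by simp)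

theorem C₀_le_monomialSpan (hVH : IsCompleteInteraction V H) {b : CrossedProduct V H}
    (hb : b ∈ C₀ V H) : b ∈ monomialSpan V H := by
  -- Left multiplication is tracked for `b` and `star b` together, so that the star step of the
  -- induction merely swaps the two halves. At `t = 1` the first half gives the claim.
  suffices h : (∀ t ∈ monomialSpan V H, b * t ∈ monomialSpan V H) ∧
      ∀ t ∈ monomialSpan V H, star b * t ∈ monomialSpan V H by
    simpa using h.1 _ (ι_mem_monomialSpan 1)
  induction hb using StarAlgebra.adjoin_induction with
  | mem b hb =>
    rcases hb with ⟨a, rfl⟩ | ⟨x, rfl⟩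
    · refine ⟨fun t ht => ι_mul_mem_monomialSpan a ht, fun t ht => ?_⟩
      rw [← map_star]
      exact ι_mul_mem_monomialSpan _ ht
    · exact ⟨fun t ht => U_mul_mem_monomialSpan hVH x ht,
        fun t ht => star_U_mul_mem_monomialSpan hVH x ht⟩
  | algebraMap z =>
    refine ⟨fun t ht => ?_, fun t ht => ?_⟩
    · rw [← Algebra.smul_def]
      exact Submodule.smul_mem _ _ ht
    · rw [← algebraMap_star_comm, ← Algebra.smul_def]
      exact Submodule.smul_mem _ _ ht
  | add b c _ _ hb hc =>
    refine ⟨fun t ht => ?_, fun t ht => ?_⟩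
    · rw [add_mul]
      exact add_mem (hb.1 t ht) (hc.1 t ht)
    · rw [star_add, add_mul]
      exact add_mem (hb.2 t ht) (hc.2 t ht)
  | mul b c _ _ hb hc =>
    refine ⟨fun t ht => ?_, fun t ht => ?_⟩
    · rw [mul_assoc]
      exact hb.1 _ (hc.1 t ht)
    · rw [star_mul, mul_assoc]
      exact hc.2 _ (hb.2 t ht)
  | star b _ hb => exact ⟨hb.2, by simpa using hb.1⟩

theorem exists_presentation (hVH : IsCompleteInteraction V H) {b : CrossedProduct V H}
    (hb : b ∈ C₀ V H) : Nonempty (Presentation b) :=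
  exists_presentation_of_mem_monomialSpan hVH (C₀_le_monomialSpan hVH hb)

theorem mk_mem_C₀ (w : Word V H) : mk w ∈ C₀ V H := by
  have hU (x : PosCone Γ) : U V H x ∈ C₀ V H := StarAlgebra.subset_adjoin _ _ (.inr ⟨x, rfl⟩)
  induction w using Word.induction with
  | scalar c =>
    rw [AlgHom.commutes]
    exact algebraMap_mem _ c
  | gen g =>
    cases g with
    | ofA a => exact StarAlgebra.subset_adjoin _ _ (.inl ⟨a, rfl⟩)
    | ofU x => exact hU x
    | ofUstar x =>
      have := star_mem (hU x)
      rwa [U, star_mk, Word.ofU, Word.star_of] at this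
  | mul v w hv hw =>
    rw [map_mul]
    exact mul_mem hv hw
  | add v w hv hw =>
    rw [map_add]
    exact add_mem hv hw

/-! ### The conditional expectation -/

/-- The sum map `A × offDiagonal → CrossedProduct`. -/
def decomp (V H : PosCone Γ → A →ₚ[ℂ] A) : A × offDiagonal V H →ₗ[ℂ] CrossedProduct V H :=
  (ι V H).toLinearMap.coprod (offDiagonal V H).subtype

@[simp] theorem decomp_apply (y : A × offDiagonal V H) : decomp V H y = ι V H y.1 + y.2 := rfl

theorem Presentation.decomp_eq {b : CrossedProduct V H} (P : Presentation b) :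
    decomp V H (P.a₀, ⟨_, P.sub_mem_offDiagonal⟩) = b := by
  simp

theorem denseRange_decomp (hVH : IsCompleteInteraction V H) : DenseRange (decomp V H) := by
  refine denseRange_mk.mono ?_
  rintro _ ⟨w, rfl⟩
  obtain ⟨P⟩ := exists_presentation hVH (mk_mem_C₀ w)
  exact ⟨_, P.decomp_eq⟩

/-- A contractive unital self-adjoint linear map between C⋆-algebras is positive. -/
theorem nonneg_map_star_mul_self {B : Type*} [CStarAlgebra B] (E : B →ₗ[ℂ] A) (h1 : E 1 = 1)
    (hE : ∀ b, ‖E b‖ ≤ ‖b‖) (hs : ∀ b, E (star b) = star (E b)) (b : B) :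
    0 ≤ E (star b * b) := by
  have ha : IsSelfAdjoint (star b * b) := .star_mul_self b
  have hEa : IsSelfAdjoint (E (star b * b)) := by
    rw [IsSelfAdjoint, ← hs, ha.star_eq]
  have hr : SpectrumRestricts (star b * b) ContinuousMap.realToNNReal :=
    SpectrumRestricts.nnreal_iff.2 spectrum_star_mul_self_nonneg
  -- Positivity of a self-adjoint `a` with `‖a‖ ≤ t` is equivalent to `‖t - a‖ ≤ t`, a condition
  -- that a unital contraction preserves; here `t = ‖b⋆b‖`.
  have hn := (SpectrumRestricts.nnreal_iff_nnnorm ha le_rfl).1 hr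
  have hr' : SpectrumRestricts (E (star b * b)) ContinuousMap.realToNNReal := by
    refine (SpectrumRestricts.nnreal_iff_nnnorm hEa (t := ‖star b * b‖₊) (hE _)).2 ?_
    have h2 : E (algebraMap ℝ B ‖star b * b‖₊ - star b * b) =
        algebraMap ℝ A ‖star b * b‖₊ - E (star b * b) := by
      rw [map_sub, IsScalarTower.algebraMap_apply ℝ ℂ B, IsScalarTower.algebraMap_apply ℝ ℂ A,
        Algebra.algebraMap_eq_smul_one, Algebra.algebraMap_eq_smul_one (A := A), map_smul, h1]
    rw [← h2]
    exact (hE _).trans hn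
  exact (StarOrderedRing.nonneg_iff_spectrum_nonneg _ hEa).2 (SpectrumRestricts.nnreal_iff.1 hr')

end CrossedProduct
end CovAlg

end

/-! ### Construction of the expectation and conclusion -/

open CovAlg CovAlg.CrossedProduct in
theorem proposition4p6 {A : Type u} [CStarAlgebra A] [PartialOrder A] [StarOrderedRing A]
    {Γ : Type v} [AddCommGroup Γ] [LinearOrder Γ] [IsOrderedAddMonoid Γ]
    (V H : CovAlg.PosCone Γ → A →ₚ[ℂ] A) (hV : CovAlg.IsFinelyRepresentable.{u, v, w} V)
    (hVH : CovAlg.IsCompleteInteraction V H) :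
    (∀ a ∈ CovAlg.CrossedProduct.C₀ V H,
      ∀ P : CovAlg.CrossedProduct.Presentation a, ‖P.a₀‖ ≤ ‖a‖) ∧
    (∀ a ∈ CovAlg.CrossedProduct.C₀ V H,
      ∃! a₀ : A, ∃ P : CovAlg.CrossedProduct.Presentation a, P.a₀ = a₀) ∧
    ∃ E : CovAlg.CrossedProduct V H →ₗ[ℂ] A,
      CovAlg.CrossedProduct.IsConditionalExpectation E ∧
      ∀ a ∈ CovAlg.CrossedProduct.C₀ V H,
        ∀ P : CovAlg.CrossedProduct.Presentation a, E a = P.a₀ := by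
  -- This bound makes the `A`-component depend only on the sum, and continuously so; hence it
  -- extends along the dense range of `decomp`.
  have hnorm (y : A × offDiagonal V H) :
      ‖LinearMap.fst ℂ A (offDiagonal V H) y‖ ≤ 1 * ‖decomp V H y‖ := by
    rw [one_mul, LinearMap.fst_apply, ← norm_ι hV hVH]
    exact norm_le_norm_add_offDiagonal (ι_mem_spectral _) y.2.2
  have hd := denseRange_decomp hVH
  let E := (LinearMap.fst ℂ A (offDiagonal V H)).extendOfNorm (decomp V H)
  have hE (y : A × offDiagonal V H) : E (decomp V H y) = y.1 :=
    LinearMap.extendOfNorm_eq hd ⟨1, hnorm⟩ y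
  have hEn (b : CrossedProduct V H) : ‖E b‖ ≤ ‖b‖ := by
    simpa using LinearMap.norm_extendOfNorm_apply_le hd 1 hnorm b
  have hEP {a : CrossedProduct V H} (P : Presentation a) : E a = P.a₀ := by
    simpa only [P.decomp_eq] using hE (P.a₀, ⟨_, P.sub_mem_offDiagonal⟩)
  have hEι (c : A) : E (ι V H c) = c := by simpa using hE (c, 0)
  -- The adjoint exchanges degrees `g` and `-g`, so it preserves `offDiagonal`; density does the
  -- rest.
  have hEs (b : CrossedProduct V H) : E (star b) = star (E b) := by
    refine hd.induction_on (p := fun b => E (star b) = star (E b)) b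
      (isClosed_eq (E.continuous.comp continuous_star') (continuous_star.comp E.continuous))
      fun y => ?_
    have h := hE (star y.1, ⟨_, star_mem_offDiagonal y.2.2⟩)
    rw [hE]
    simpa [star_add, map_star] using h
  refine ⟨fun a _ P => hEP P ▸ hEn a, fun a ha => ?_, E.toLinearMap, ⟨hEι, hEn, ?_, ?_⟩,
    fun a _ P => hEP P⟩
  · obtain ⟨P⟩ := exists_presentation hVH ha
    refine ⟨P.a₀, ⟨P, rfl⟩, ?_⟩
    rintro _ ⟨Q, rfl⟩
    rw [← hEP P, hEP Q]
  · exact nonneg_map_star_mul_self E.toLinearMap (by simpa using hEι 1) hEn hEs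
  · intro c b d
    refine hd.induction_on (p := fun b => E (ι V H c * b * ι V H d) = c * E b * d) b
      (isClosed_eq (by fun_prop) (by fun_prop)) fun y => ?_
    have h := hE (c * y.1 * d, ⟨_, ι_mul_mul_ι_mem_offDiagonal y.2.2 c d⟩)
    rw [hE]
    simpa [mul_add, add_mul] using h
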